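/- Let all sequences and infinite matrices be indexed by $\mathbb N_0$ and have entries in $\mathbb K=\mathbb R$ or $\mathbb K=\mathbb C$; let $c_0$, $c$, $\ell_\infty$ be the spaces of null, convergent and bounded sequences. Let $r=(r_n)$, $s=(s_n)$, $t=(t_n)$ be sequences with $r_n\neq 0$ and $t_n\neq0$ for all $n$ and $s_0\neq 0$, and let $$c(r,s,t;\Delta)=\Big\{x=(x_n):\ \Big(\tfrac1{r_n}\sum_{k=0}^n s_{n-k}t_k(x_k-x_{k-1})\Big)_{n}\in c\Big\},\qquad x_{-1}:=0 .$$ Put $D^{(s)}_0=1/s_0$ and, for $n\ge1$, $D^{(s)}_n=s_0^{-(n+1)}\det(s_{i-j+1})_{1\le i,j\le n}$, where $s_i:=0$ for $i<0$. Let $S=(s_{jk})$ be the inverse of the triangle defining $c(r,s,t;\Delta)$, namely $$s_{jk}=r_k\sum_{l=0}^{j-k}(-1)^l\frac{D^{(s)}_l}{t_{l+k}}\quad(0\le k\le j),\qquad s_{jk}=0\quad(k>j).$$ For an infinite matrix $A=(a_{nk})$ with rows $A_n=(a_{nk})_k$ put $$R_k(A_n)=\sum_{j=k}^\infty a_{nj}s_{jk},\qquad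 w^{A_n}_{mk}=\sum_{j=m}^\infty a_{nj}s_{jk}\ \ (0\le k\le m),\qquad w^{A_n}_{mk}=0\ \ (k>m),\qquad \gamma_n=\lim_{m\to\infty}\sum_{k=0}^m w^{A_n}_{mk}.$$ Series converge in the sense of their partial sums. For a set $Y$ of sequences, $A\in(c(r,s,t;\Delta),Y)$ means that for every $x\in c(r,s,t;\Delta)$ all the series $(Ax)_n=\sum_k a_{nk}x_k$ converge and $((Ax)_n)_n\in Y$. Consider the conditions * (0) for all $n,k$ the series defining $R_k(A_n)$ converges (hence so do those defining $w^{A_n}_{mk}$); * (4.12) $\sup_n\sum_{k=0}^\infty|R_k(A_n)|<\infty$; * (4.13) $\lim_{n\to\infty}R_k(A_n)=0$ for all $k$; * (4.14) $\sup_m\sum_{k=0}^m|w^{A_n}_{mk}|<\infty$ for all $n$; * (4.16) $\lim_{n\to\infty}R_k(A_n)$ exists for all $k$; * (4.20) $\lim_{m\to\infty}w^{A_n}_{mk}$ exists for all $n,k$; * (4.21) $\lim_{m\to\infty}\sum_{k=0}^m w^{A_n}_{mk}$ exists for all $n$; * (4.22), (4.23), (4.24): the sequence $\big(\sum_{k=0}^\infty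 R_k(A_n)-\gamma_n\big)_{n}$ belongs to $c_0$, to $\ell_\infty$, to $c$, respectively. Then: (a) $A\in(c(r,s,t;\Delta),c_0)$ if and only if (0), (4.12), (4.13), (4.14), (4.20), (4.21) and (4.22) hold. (b) $A\in(c(r,s,t;\Delta),c)$ if and only if (0), (4.12), (4.14), (4.16), (4.20), (4.21) and (4.24) hold. (c) $A\in(c(r,s,t;\Delta),\ell_\infty)$ if and only if (0), (4.12), (4.14), (4.20), (4.21) and (4.23) hold. -/

import Mathlib

open Filter Topology

noncomputable section

namespace GenMeans

/-! ### Sequence spaces and infinite matrices -/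

section Spaces

variable {𝕜 : Type*} [RCLike 𝕜]

/-- The space of bounded sequences. -/
def spaceLinf (𝕜 : Type*) [RCLike 𝕜] : Set (ℕ → 𝕜) :=
  {x | BddAbove (Set.range fun n => ‖x n‖)}

/-- The space of convergent sequences. -/
def spaceC (𝕜 : Type*) [RCLike 𝕜] : Set (ℕ → 𝕜) :=
  {x | ∃ l : 𝕜, Tendsto x atTop (𝓝 l)}

/-- The space of null sequences. -/
def spaceC0 (𝕜 : Type*) [RCLike 𝕜] : Set (ℕ → 𝕜) :=
  {x | Tendsto x atTop (𝓝 0)}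

/-- Convergence of a series in the sense of its partial sums (possibly only conditional). -/
def SeriesConverges (f : ℕ → 𝕜) : Prop :=
  ∃ l : 𝕜, Tendsto (fun N => ∑ j ∈ Finset.range N, f j) atTop (𝓝 l)

/-- The limit of the partial sums; meaningful when `SeriesConverges f`. -/
def seriesSum (f : ℕ → 𝕜) : 𝕜 :=
  limUnder atTop (fun N => ∑ j ∈ Finset.range N, f j)

/-- The `A`-transform `(A x)_n = ∑_k a_{nk} x_k`. -/
def transform (A : ℕ → ℕ → 𝕜) (x : ℕ → 𝕜) : ℕ → 𝕜 :=
  fun n => seriesSum fun k => A n k * x k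

/-- The class `(U, V)` of infinite matrices: for every `x ∈ U` all the series `(A x)_n` converge
and `A x ∈ V`. -/
def matrixClass (U V : Set (ℕ → 𝕜)) : Set (ℕ → ℕ → 𝕜) :=
  {A | ∀ x ∈ U, (∀ n, SeriesConverges fun k => A n k * x k) ∧ transform A x ∈ V}

/-- The backward difference `Δ x_k = x_k - x_{k-1}`, with `x_{-1} = 0`. -/
def diff (x : ℕ → 𝕜) (k : ℕ) : 𝕜 :=
  if k = 0 then x 0 else x k - x (k - 1)

/-- The space `X(r, s, t; Δ)`. -/
def genMeansSpace (X : Set (ℕ → 𝕜)) (r s t : ℕ → 𝕜) : Set (ℕ → 𝕜) :=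
  {x | (fun n => 1 / r n * ∑ k ∈ Finset.range (n + 1), s (n - k) * t k * diff x k) ∈ X}

end Spaces

/-! ### The inverse of the triangle `A(r, s, t) · Δ` -/

section Inverse

variable {𝕜 : Type*} [Field 𝕜]

/-- The `n × n` matrix with entry `s_{i - j + 1}` in row `i` and column `j`, where `s` is `0` at
negative indices. -/
def hessenberg (s : ℕ → 𝕜) (n : ℕ) : Matrix (Fin n) (Fin n) 𝕜 :=
  Matrix.of fun i j => if (j : ℕ) ≤ (i : ℕ) + 1 then s ((i : ℕ) + 1 - (j : ℕ)) else 0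

/-- `D_n^{(s)}`; for `n = 0` the determinant is empty and the value is `1 / s_0`. -/
def detCoeff (s : ℕ → 𝕜) (n : ℕ) : 𝕜 :=
  1 / s 0 ^ (n + 1) * (hessenberg s n).det

/-- The matrix `S = (s_{jk})` inverse to the triangle `A(r, s, t) · Δ`. -/
def invTriangle (r s t : ℕ → 𝕜) (j k : ℕ) : 𝕜 :=
  if k ≤ j then
    ∑ l ∈ Finset.range (j - k + 1), (-1) ^ l * (detCoeff s l / t (l + k)) * r k
  else 0

end Inverse

/-! ### The matrices `B^A = (R_k(A_n))` and `W^{A_n}`, and the conditions -/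

section Conditions

variable {𝕜 : Type*} [RCLike 𝕜] (r s t : ℕ → 𝕜) (A : ℕ → ℕ → 𝕜)

/-- All the series `∑_j a_{nj} s_{jk}` converge, i.e. `R_k(A_n)` and `W^{A_n}` are defined. -/
def RDefined : Prop :=
  ∀ n k, SeriesConverges fun j => A n j * invTriangle r s t j k

/-- `R_k(A_n) = ∑_{j ≥ k} a_{nj} s_{jk}` (the terms with `j < k` vanish), where `R = Sᵗ`. -/
def rowR (n k : ℕ) : 𝕜 :=
  seriesSum fun j => A n j * invTriangle r s t j k

/-- The entry `w_{mk}` of the triangle `W^{A_n}`: `∑_{j ≥ m} a_{nj} s_{jk}` for `k ≤ m`, and `0`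
for `k > m`. -/
def rowW (n m k : ℕ) : 𝕜 :=
  if k ≤ m then seriesSum fun i => A n (m + i) * invTriangle r s t (m + i) k else 0

/-- `γ_n`, the limit of the row sums of `W^{A_n}`; meaningful when this limit exists. -/
def gammaLim (n : ℕ) : 𝕜 :=
  limUnder atTop fun m => ∑ k ∈ Finset.range (m + 1), rowW r s t A n m k

/-- `sup_n ∑_k |R_k(A_n)| < ∞`. -/
def RRowsBounded : Prop :=
  (⨆ n, ∑' k, ‖rowR r s t A n k‖ₑ) < ⊤

/-- `lim_n R_k(A_n) = 0` for all `k`. -/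
def RColumnsNull : Prop :=
  ∀ k, Tendsto (fun n => rowR r s t A n k) atTop (𝓝 0)

/-- `lim_n R_k(A_n)` exists for all `k`. -/
def RColumnsConverge : Prop :=
  ∀ k, ∃ l : 𝕜, Tendsto (fun n => rowR r s t A n k) atTop (𝓝 l)

/-- `sup_m ∑_{k ≤ m} |w^{A_n}_{mk}| < ∞` for all `n`. -/
def WRowsBounded : Prop :=
  ∀ n, BddAbove (Set.range fun m => ∑ k ∈ Finset.range (m + 1), ‖rowW r s t A n m k‖)

/-- `lim_m w^{A_n}_{mk}` exists for all `n, k`. -/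
def WColumnsConverge : Prop :=
  ∀ n k, ∃ l : 𝕜, Tendsto (fun m => rowW r s t A n m k) atTop (𝓝 l)

/-- `lim_m ∑_{k ≤ m} w^{A_n}_{mk}` exists for all `n`. -/
def WRowSumsConverge : Prop :=
  ∀ n, ∃ l : 𝕜,
    Tendsto (fun m => ∑ k ∈ Finset.range (m + 1), rowW r s t A n m k) atTop (𝓝 l)

/-- The sequence `(R_k(A_n)) e - (γ_n)`, whose `n`-th term is `∑_k R_k(A_n) - γ_n`. -/
def defect : ℕ → 𝕜 :=
  fun n => transform (rowR r s t A) (fun _ => 1) n - gammaLim r s t A n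

end Conditions

end GenMeans

end

/-! Since `S` inverts the defining triangle, the space is `S c`. For `x = S y`, interchanging finite
sums turns the partial sums of `(A x)_n` into a triangle `V` (`partialR`, depending on `n`) applied
to `y`. Its entries are the partial sums of the series for `R_k(A_n)`, so on `k ≤ m` it equals `R -
W`. Convergence of `(A x)_n` for all `x` therefore means that `V` maps `c` into `c`.
Banach–Steinhaus on `c₀` makes the rows of `V` uniformly `ℓ₁`-bounded, and testing on `e = (1, 1,
...)` gives limits of row sums; these translate into the conditions on `W`.

Splitting `y = (y - l) + l e` with `l = lim y` gives `(A x)_n = ∑_k R_k(A_n) (y_k - l) + l d_n`,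
where `d` is `defect` (`tendsto_sum_mul_invTransform`). Null `y` and `y = e` then separate
membership in `Y` into two conditions: `(R_k(A_n))` maps `c₀` into `Y`, and `d ∈ Y`
(`mem_matrixClass_iff`). The former is settled by the classical Toeplitz-type lemmas
`mapsTo_spaceC0_iff`, `mapsTo_spaceC_iff`, `mapsTo_spaceLinf_iff`. -/

noncomputable section

namespace GenMeans

/-! ### Reciprocal power series and Hessenberg determinants. -/

section Inverse

variable {𝕜 : Type*} [Field 𝕜]

/-- The coefficients of the inverse of `∑ s_n X^n` are the signed Hessenberg determinants. -/
theorem coeff_inv_mk (s : ℕ → 𝕜) (hs : s 0 ≠ 0) (n : ℕ) :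
    PowerSeries.coeff n (PowerSeries.mk s)⁻¹ = (-1) ^ n * detCoeff s n := by
  set c : ℕ → 𝕜 := fun n => PowerSeries.coeff n (PowerSeries.mk s)⁻¹ with hc
  have hmul : PowerSeries.mk s * (PowerSeries.mk s)⁻¹ = 1 :=
    PowerSeries.mul_inv_cancel _ (by simpa using hs)
  let T : Matrix (Fin (n + 1)) (Fin (n + 1)) 𝕜 :=
    Matrix.of fun i j => if (j : ℕ) ≤ i then s ((i : ℕ) - j) else 0
  have hdet : T.det = s 0 ^ (n + 1) := by
    rw [Matrix.det_of_isLowerTriangular]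
    · simp [T]
    · intro i j hij
      have hij' : i < j := hij
      have : ¬ ((j : ℕ) ≤ i) := not_le.mpr hij'
      simp only [T, Matrix.of_apply, if_neg this]
  have hT : T.mulVec (fun j => c j) = Pi.single 0 1 := by
    ext i
    have h1 := congrArg (PowerSeries.coeff (i : ℕ)) hmul
    rw [mul_comm, PowerSeries.coeff_mul, Finset.Nat.sum_antidiagonal_eq_sum_range_succ
      (fun a b => PowerSeries.coeff a (PowerSeries.mk s)⁻¹ *
        PowerSeries.coeff b (PowerSeries.mk s)), PowerSeries.coeff_one] at h1
    have h2 : (T.mulVec fun j => c j) i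
        = ∑ j ∈ Finset.range (n + 1), (if j ≤ (i : ℕ) then s ((i : ℕ) - j) else 0) * c j :=
      Fin.sum_univ_eq_sum_range
        (fun j => (if j ≤ (i : ℕ) then s ((i : ℕ) - j) else 0) * c j) (n + 1)
    have h3 : (Pi.single 0 1 : Fin (n + 1) → 𝕜) i = if (i : ℕ) = 0 then 1 else 0 := by
      by_cases hi : i = 0
      · simp [hi]
      · have : (i : ℕ) ≠ 0 := fun h => hi (Fin.ext h)
        simp [hi]
    rw [h2, h3, ← h1]
    symm
    refine Finset.sum_subset_zero_on_sdiff ?_ ?_ ?_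
    · intro k hk
      have := i.isLt
      simp only [Finset.mem_range] at hk ⊢
      omega
    · intro k hk
      have : ¬ k ≤ (i : ℕ) := by
        simp only [Finset.mem_sdiff, Finset.mem_range] at hk
        omega
      simp [this]
    · intro k hk
      have : k ≤ (i : ℕ) := by
        simp only [Finset.mem_range] at hk
        omega
      simp [this, hc, mul_comm]
  -- Cramer's rule: the last coordinate of `adj(T) T c` is `det T * c n`, and on the other side
  -- stands the cofactor deleting row `0` and the last column.
  have hadj := congrArg (fun v => T.adjugate.mulVec v (Fin.last n)) hT
  simp only [Matrix.mulVec_mulVec, Matrix.adjugate_mul, Matrix.smul_mulVec, Matrix.one_mulVec,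
    Matrix.mulVec_single_one, Pi.smul_apply, Fin.val_last, smul_eq_mul, Matrix.col_apply, hdet,
    Matrix.adjugate_fin_succ_eq_det_submatrix] at hadj
  have hsub : T.submatrix (Fin.succAbove 0) (Fin.last n).succAbove = hessenberg s n := by
    ext i j
    simp only [T, hessenberg, Matrix.submatrix_apply, Matrix.of_apply, Fin.succAbove_last,
      Fin.succAbove_zero, Fin.val_succ, Fin.val_castSucc]
  rw [hsub] at hadj
  have h0 : s 0 ^ (n + 1) ≠ 0 := pow_ne_zero _ hs
  change c n = _
  rw [detCoeff]
  field_simp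
  rw [mul_comm, hadj]
  simp

end Inverse

/-! ### Inversion of the triangle by generating functions. -/

section Triangle

variable {𝕜 : Type*} [RCLike 𝕜]

theorem forall_diff_eq_iff (x v : ℕ → 𝕜) :
    (∀ k, diff x k = v k) ↔ ∀ j, x j = ∑ k ∈ Finset.range (j + 1), v k := by
  constructor
  · intro h j
    induction j with
    | zero => simp [← h, diff]
    | succ j ih =>
      rw [Finset.sum_range_succ, ← ih, ← h (j + 1)]
      simp [diff]
  · intro h k
    cases k with
    | zero => simp [diff, h]
    | succ k => simp [diff, h, Finset.sum_range_succ]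

theorem invTriangle_of_lt (r s t : ℕ → 𝕜) {j k : ℕ} (h : j < k) : invTriangle r s t j k = 0 := by
  simp [invTriangle, not_le.mpr h]

/-- `S` is inverse to the triangle which defines `X(r, s, t; Δ)`. -/
theorem genMeans_eq_iff (r s t : ℕ → 𝕜) (hr : ∀ n, r n ≠ 0) (hs : s 0 ≠ 0) (ht : ∀ n, t n ≠ 0)
    (x y : ℕ → 𝕜) :
    (∀ n, 1 / r n * ∑ k ∈ Finset.range (n + 1), s (n - k) * t k * diff x k = y n) ↔
      ∀ j, x j = ∑ k ∈ Finset.range (j + 1), invTriangle r s t j k * y k := by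
  have h0 : PowerSeries.constantCoeff (PowerSeries.mk s) ≠ 0 := by simpa using hs
  -- The means are a Cauchy product of `s` with `t_k Δx_k`, so inverting them is division by the
  -- power series of `s`.
  have h1 : (∀ n, 1 / r n * ∑ k ∈ Finset.range (n + 1), s (n - k) * t k * diff x k = y n) ↔
      (PowerSeries.mk fun k => t k * diff x k) * PowerSeries.mk s
        = PowerSeries.mk fun n => r n * y n := by
    rw [PowerSeries.ext_iff]
    refine forall_congr' fun n => ?_
    rw [PowerSeries.coeff_mul, Finset.Nat.sum_antidiagonal_eq_sum_range_succ
      (fun a b => PowerSeries.coeff a (PowerSeries.mk fun k => t k * diff x k) *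
        PowerSeries.coeff b (PowerSeries.mk s))]
    simp only [PowerSeries.coeff_mk]
    rw [one_div, inv_mul_eq_iff_eq_mul₀ (hr n)]
    refine Eq.congr (Finset.sum_congr rfl fun k _ => by ring) rfl
  have h2 : (PowerSeries.mk fun k => t k * diff x k) * PowerSeries.mk s
        = (PowerSeries.mk fun n => r n * y n) ↔
      (PowerSeries.mk fun k => t k * diff x k)
        = (PowerSeries.mk fun n => r n * y n) * (PowerSeries.mk s)⁻¹ :=
    (PowerSeries.eq_mul_inv_iff_mul_eq h0).symm
  have h3 : (PowerSeries.mk fun k => t k * diff x k)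
        = (PowerSeries.mk fun n => r n * y n) * (PowerSeries.mk s)⁻¹ ↔
      ∀ k, diff x k = (∑ i ∈ Finset.range (k + 1),
        r i * y i * ((-1) ^ (k - i) * detCoeff s (k - i))) / t k := by
    rw [PowerSeries.ext_iff]
    refine forall_congr' fun n => ?_
    rw [PowerSeries.coeff_mul, Finset.Nat.sum_antidiagonal_eq_sum_range_succ
      (fun a b => PowerSeries.coeff a (PowerSeries.mk fun n => r n * y n) *
        PowerSeries.coeff b (PowerSeries.mk s)⁻¹)]
    simp only [PowerSeries.coeff_mk, coeff_inv_mk s hs]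
    rw [eq_div_iff (ht n), mul_comm]
  rw [h1, h2, h3, forall_diff_eq_iff]
  refine forall_congr' fun j => ?_
  refine Eq.congr rfl ?_
  simp only [Finset.sum_div]
  have h4 : ∀ k ∈ Finset.range (j + 1), invTriangle r s t j k * y k =
      ∑ l ∈ Finset.range (j - k + 1), (-1) ^ l * (detCoeff s l / t (l + k)) * r k * y k :=
    fun k hk => by
      rw [invTriangle, if_pos (Nat.lt_succ_iff.mp (Finset.mem_range.mp hk)), Finset.sum_mul]
  rw [Finset.sum_congr rfl h4, Finset.sum_sigma', Finset.sum_sigma']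
  -- Pairs `i ≤ k ≤ j` are reindexed by `(i, l)` with `l = k - i`.
  refine Finset.sum_bij' (fun p _ => ⟨p.2, p.1 - p.2⟩) (fun p _ => ⟨p.2 + p.1, p.1⟩) ?_ ?_ ?_ ?_ ?_
  · rintro ⟨a, b⟩ h
    simp only [Finset.mem_sigma, Finset.mem_range] at h ⊢
    omega
  · rintro ⟨a, b⟩ h
    simp only [Finset.mem_sigma, Finset.mem_range] at h ⊢
    omega
  · rintro ⟨a, b⟩ h
    simp only [Finset.mem_sigma, Finset.mem_range] at h
    simp only [Sigma.mk.injEq, heq_eq_eq, and_true]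
    omega
  · rintro ⟨a, b⟩ h
    simp
  · rintro ⟨a, b⟩ h
    simp only [Finset.mem_sigma, Finset.mem_range] at h
    have : a - b + b = a := by omega
    simp only [this]
    ring

end Triangle

/-! ### Functionals on `c₀` and matrices with uniformly `ℓ₁`-bounded rows. -/

section Analysis

variable {𝕜 : Type*} [RCLike 𝕜]

theorem tendsto_cocompact_nat {y : ℕ → 𝕜} (hy : Tendsto y atTop (𝓝 0)) :
    Tendsto y (cocompact ℕ) (𝓝 0) := by
  rwa [cocompact_eq_cofinite, Nat.cofinite_eq_atTop]

theorem norm_zeroAtInfty_apply_le (f : ZeroAtInftyContinuousMap ℕ 𝕜) (k : ℕ) : ‖f k‖ ≤ ‖f‖ := by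
  rw [← ZeroAtInftyContinuousMap.norm_toBCF_eq_norm]
  exact f.toBCF.norm_coe_le_norm k

theorem norm_zeroAtInfty_le (f : ZeroAtInftyContinuousMap ℕ 𝕜) {C : ℝ} (hC : 0 ≤ C)
    (h : ∀ k, ‖f k‖ ≤ C) : ‖f‖ ≤ C := by
  rw [← ZeroAtInftyContinuousMap.norm_toBCF_eq_norm]
  exact (BoundedContinuousFunction.norm_le hC).mpr h

/-- A finitely supported sequence as an element of the Banach space `c₀`. -/
def truncZeroAtInfty (z : ℕ → 𝕜) (N : ℕ) : ZeroAtInftyContinuousMap ℕ 𝕜 where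
  toFun k := if k < N then z k else 0
  continuous_toFun := continuous_of_discreteTopology
  zero_at_infty' := by
    refine tendsto_cocompact_nat (tendsto_const_nhds.congr' ?_)
    filter_upwards [eventually_ge_atTop N] with k hk
    simp [not_lt.mpr hk]

/-- The functional `y ↦ ∑ b_k y_k` on `c₀`. -/
def pairing (b : ℕ → 𝕜) (hb : Summable fun k => ‖b k‖) : ZeroAtInftyContinuousMap ℕ 𝕜 →L[𝕜] 𝕜 :=
  have hs : ∀ f : ZeroAtInftyContinuousMap ℕ 𝕜, Summable fun k => ‖b k * f k‖ := fun f =>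
    Summable.of_nonneg_of_le (fun _ => norm_nonneg _)
      (fun k => by
        rw [norm_mul]
        exact mul_le_mul_of_nonneg_left (norm_zeroAtInfty_apply_le f k) (norm_nonneg _))
      (hb.mul_right ‖f‖)
  LinearMap.mkContinuous
    { toFun := fun f => ∑' k, b k * f k
      map_add' := fun f g => by
        rw [← (hs f).of_norm.tsum_add (hs g).of_norm]
        simp [mul_add]
      map_smul' := fun c f => by
        rw [RingHom.id_apply, smul_eq_mul, ← tsum_mul_left]
        refine tsum_congr fun k => ?_
        simp only [ZeroAtInftyContinuousMap.smul_apply, smul_eq_mul]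
        ring }
    (∑' k, ‖b k‖) (fun f => by
      refine (norm_tsum_le_tsum_norm (hs f)).trans ?_
      rw [← tsum_mul_right]
      refine (hs f).tsum_le_tsum (fun k => ?_) (hb.mul_right _)
      rw [norm_mul]
      exact mul_le_mul_of_nonneg_left (norm_zeroAtInfty_apply_le f k) (norm_nonneg _))

theorem pairing_apply (b : ℕ → 𝕜) (hb : Summable fun k => ‖b k‖)
    (f : ZeroAtInftyContinuousMap ℕ 𝕜) : pairing b hb f = ∑' k, b k * f k := rfl

/-- The nontrivial half of the isometry between `ℓ₁` and the dual of `c₀`, obtained by testing on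
truncated conjugate phases. -/
theorem sum_norm_le_norm_pairing (b : ℕ → 𝕜) (hb : Summable fun k => ‖b k‖) (N : ℕ) :
    ∑ k ∈ Finset.range N, ‖b k‖ ≤ ‖pairing b hb‖ := by
  -- Where `b k = 0` the quotient is `0` by convention, which is harmless.
  set f := truncZeroAtInfty (fun k => (starRingEnd 𝕜) (b k) / (‖b k‖ : 𝕜)) N with hf
  have hnorm : ‖f‖ ≤ 1 := by
    refine norm_zeroAtInfty_le f zero_le_one fun k => ?_
    change ‖if k < N then (starRingEnd 𝕜) (b k) / (‖b k‖ : 𝕜) else 0‖ ≤ 1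
    split_ifs
    · simpa using div_self_le_one ‖b k‖
    · simp
  have hval : pairing b hb f = ((∑ k ∈ Finset.range N, ‖b k‖ : ℝ) : 𝕜) := by
    rw [pairing_apply, tsum_eq_sum (s := Finset.range N)]
    · push_cast
      refine Finset.sum_congr rfl fun k hk => ?_
      change b k * (if k < N then (starRingEnd 𝕜) (b k) / (‖b k‖ : 𝕜) else 0) = _
      rw [if_pos (Finset.mem_range.mp hk), mul_div_assoc', RCLike.mul_conj]
      by_cases h0 : (‖b k‖ : 𝕜) = 0
      · simp [h0]
      · field_simp
    · intro k hk
      change b k * (if k < N then (starRingEnd 𝕜) (b k) / (‖b k‖ : 𝕜) else 0) = _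
      rw [if_neg (by simpa using hk), mul_zero]
  have h := (pairing b hb).le_opNorm_of_le hnorm
  rw [hval, RCLike.norm_ofReal, abs_of_nonneg (Finset.sum_nonneg fun _ _ => norm_nonneg _),
    mul_one] at h
  exact h

/-- The rows of `B` are uniformly bounded in `ℓ₁`. -/
def RowsBounded (B : ℕ → ℕ → 𝕜) : Prop :=
  ∃ C : ℝ, ∀ n N, ∑ k ∈ Finset.range N, ‖B n k‖ ≤ C

theorem RowsBounded.summable {B : ℕ → ℕ → 𝕜} (h : RowsBounded B) (n : ℕ) :
    Summable fun k => ‖B n k‖ := by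
  obtain ⟨C, hC⟩ := h
  exact summable_of_sum_range_le (fun _ => norm_nonneg _) (hC n)

/-- Uniform boundedness principle for matrices acting on null sequences. -/
theorem rowsBounded_of_bounded (B : ℕ → ℕ → 𝕜) (hB : ∀ n, Summable fun k => ‖B n k‖)
    (h : ∀ y : ℕ → 𝕜, Tendsto y atTop (𝓝 0) →
      BddAbove (Set.range fun n => ‖∑' k, B n k * y k‖)) : RowsBounded B := by
  obtain ⟨C, hC⟩ := banach_steinhaus (g := fun n => pairing (B n) (hB n)) fun f => by
    have hf : Tendsto f atTop (𝓝 0) := by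
      have := f.zero_at_infty'
      rwa [cocompact_eq_cofinite, Nat.cofinite_eq_atTop] at this
    obtain ⟨C, hC⟩ := h f hf
    exact ⟨C, fun n => hC ⟨n, rfl⟩⟩
  exact ⟨C, fun n N => (sum_norm_le_norm_pairing _ _ _).trans (hC n)⟩

theorem summable_norm_mul_of_tendsto {b y : ℕ → 𝕜} (hb : Summable fun k => ‖b k‖) {l : 𝕜}
    (hy : Tendsto y atTop (𝓝 l)) : Summable fun k => ‖b k * y k‖ := by
  obtain ⟨M, hM⟩ := hy.norm.bddAbove_range
  refine Summable.of_nonneg_of_le (fun _ => norm_nonneg _) (fun k => ?_) (hb.mul_right M)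
  rw [norm_mul]
  exact mul_le_mul_of_nonneg_left (hM ⟨k, rfl⟩) (norm_nonneg _)

/-- Beyond some `K` the sequence `y` is small, so the tail is controlled uniformly by the row bound;
the finite head vanishes by the columns. -/
theorem tendsto_tsum_mul_zero {B : ℕ → ℕ → 𝕜} (hB : RowsBounded B)
    (hcol : ∀ k, Tendsto (fun n => B n k) atTop (𝓝 0)) {y : ℕ → 𝕜} (hy : Tendsto y atTop (𝓝 0)) :
    Tendsto (fun n => ∑' k, B n k * y k) atTop (𝓝 0) := by
  have hsum := hB.summable
  obtain ⟨C, hC⟩ := hB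
  have hC0 : 0 ≤ C := by simpa using hC 0 0
  rw [Metric.tendsto_atTop]
  intro ε hε
  -- `C + 1` allows `C = 0` and makes `δ * C < ε / 2` strict.
  set δ := ε / (2 * (C + 1)) with hδ
  have hδ0 : 0 < δ := by positivity
  obtain ⟨K, hK⟩ := Metric.tendsto_atTop.mp hy δ hδ0
  have hfin : Tendsto (fun n => ∑ k ∈ Finset.range K, B n k * y k) atTop (𝓝 0) := by
    have := tendsto_finsetSum (Finset.range K) fun k _ => (hcol k).mul_const (y k)
    simpa using this
  obtain ⟨M, hM⟩ := Metric.tendsto_atTop.mp hfin (ε / 2) (by positivity)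
  refine ⟨M, fun n hn => ?_⟩
  have hs := summable_norm_mul_of_tendsto (hsum n) hy
  have htail : ‖∑' k, B n (k + K) * y (k + K)‖ ≤ δ * C := by
    have hs' : Summable fun k => ‖B n (k + K)‖ := 
      (summable_nat_add_iff (f := fun k => ‖B n k‖) K).mpr (hsum n)
    have hs2 : Summable fun k => ‖B n (k + K) * y (k + K)‖ := 
      (summable_nat_add_iff (f := fun k => ‖B n k * y k‖) K).mpr hs
    refine (norm_tsum_le_tsum_norm hs2).trans ?_
    calc ∑' k, ‖B n (k + K) * y (k + K)‖ ≤ ∑' k, δ * ‖B n (k + K)‖ := by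
          refine hs2.tsum_le_tsum (fun k => ?_) (hs'.mul_left δ)
          rw [norm_mul, mul_comm]
          have := hK (k + K) (by omega)
          rw [dist_zero_right] at this
          gcongr
      _ = δ * ∑' k, ‖B n (k + K)‖ := tsum_mul_left
      _ ≤ δ * C := by
          gcongr
          refine le_trans ?_ ((hsum n).tsum_le_of_sum_range_le (hC n))
          rw [← (hsum n).sum_add_tsum_nat_add K]
          exact le_add_of_nonneg_left (Finset.sum_nonneg fun _ _ => norm_nonneg _)
  have hlt : δ * C < ε / 2 := by
    have : δ * (C + 1) = ε / 2 := by rw [hδ]; field_simp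
    linarith
  have hhead := hM n hn
  rw [dist_zero_right] at hhead ⊢
  rw [← hs.of_norm.sum_add_tsum_nat_add K]
  refine (norm_add_le _ _).trans_lt ?_
  linarith

theorem sum_norm_le_of_tendsto {B : ℕ → ℕ → 𝕜} {C : ℝ}
    (hC : ∀ n N, ∑ k ∈ Finset.range N, ‖B n k‖ ≤ C) {b : ℕ → 𝕜}
    (hcol : ∀ k, Tendsto (fun n => B n k) atTop (𝓝 (b k))) (N : ℕ) :
    ∑ k ∈ Finset.range N, ‖b k‖ ≤ C :=
  le_of_tendsto' (tendsto_finsetSum _ fun k _ => (hcol k).norm) fun n => hC n N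

/-- A matrix with bounded rows and convergent columns acts continuously on null sequences. -/
theorem tendsto_tsum_mul {B : ℕ → ℕ → 𝕜} (hB : RowsBounded B) {b : ℕ → 𝕜}
    (hcol : ∀ k, Tendsto (fun n => B n k) atTop (𝓝 (b k))) {y : ℕ → 𝕜}
    (hy : Tendsto y atTop (𝓝 0)) :
    Tendsto (fun n => ∑' k, B n k * y k) atTop (𝓝 (∑' k, b k * y k)) := by
  have hsum := hB.summable
  obtain ⟨C, hC⟩ := hB
  have hb := sum_norm_le_of_tendsto hC hcol
  have hbs : Summable fun k => ‖b k‖ := summable_of_sum_range_le (fun _ => norm_nonneg _) hb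
  -- Subtracting the limit row, which inherits the bound `C`, reduces to null columns.
  have hD : RowsBounded fun n k => B n k - b k := by
    refine ⟨C + C, fun n N => ?_⟩
    refine (Finset.sum_le_sum fun k _ => norm_sub_le _ _).trans ?_
    rw [Finset.sum_add_distrib]
    exact add_le_add (hC n N) (hb N)
  have h := tendsto_tsum_mul_zero hD (fun k => by simpa using (hcol k).sub_const (b k)) hy
  have h2 := h.add_const (∑' k, b k * y k)
  rw [zero_add] at h2
  refine h2.congr fun n => ?_
  rw [← (summable_norm_mul_of_tendsto (hD.summable n) hy).of_norm.tsum_add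
    (summable_norm_mul_of_tendsto hbs hy).of_norm]
  exact tsum_congr fun k => by ring

theorem SeriesConverges.tendsto {f : ℕ → 𝕜} (h : SeriesConverges f) :
    Tendsto (fun N => ∑ j ∈ Finset.range N, f j) atTop (𝓝 (seriesSum f)) :=
  tendsto_nhds_limUnder h

theorem seriesSum_eq_of_tendsto {f : ℕ → 𝕜} {l : 𝕜}
    (h : Tendsto (fun N => ∑ j ∈ Finset.range N, f j) atTop (𝓝 l)) : seriesSum f = l :=
  h.limUnder_eq

theorem seriesSum_eq_tsum {f : ℕ → 𝕜} (h : Summable f) : seriesSum f = ∑' k, f k :=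
  seriesSum_eq_of_tendsto h.hasSum.tendsto_sum_nat

theorem iSup_tsum_enorm_lt_top_iff (B : ℕ → ℕ → 𝕜) :
    (⨆ n, ∑' k, ‖B n k‖ₑ) < ⊤ ↔ RowsBounded B := by
  have key : ∀ n N, ∑ k ∈ Finset.range N, ‖B n k‖ₑ
      = ENNReal.ofReal (∑ k ∈ Finset.range N, ‖B n k‖) := fun n N => by
    rw [ENNReal.ofReal_sum_of_nonneg fun _ _ => norm_nonneg _]
    exact Finset.sum_congr rfl fun k _ => (ofReal_norm _).symm
  constructor
  · intro h
    refine ⟨(⨆ n, ∑' k, ‖B n k‖ₑ).toReal, fun n N => ?_⟩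
    rw [← ENNReal.ofReal_le_iff_le_toReal h.ne, ← key]
    exact (ENNReal.sum_le_tsum _).trans (le_iSup (fun n => ∑' k, ‖B n k‖ₑ) n)
  · rintro ⟨C, hC⟩
    refine lt_of_le_of_lt (iSup_le fun n => ?_) (ENNReal.ofReal_lt_top (r := C))
    rw [ENNReal.tsum_eq_iSup_nat]
    refine iSup_le fun N => ?_
    rw [key]
    exact ENNReal.ofReal_le_ofReal (hC n N)

end Analysis

/-! ### Matrix maps from `c₀` into `ℓ∞`, `c` and `c₀`. -/

section NullSequences

variable {𝕜 : Type*} [RCLike 𝕜] {B : ℕ → ℕ → 𝕜}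

theorem tendsto_single_zero (k : ℕ) : Tendsto (Pi.single k 1 : ℕ → 𝕜) atTop (𝓝 0) := by
  refine tendsto_const_nhds.congr' ?_
  filter_upwards [eventually_gt_atTop k] with j hj
  rw [Pi.single_eq_of_ne hj.ne']

theorem tsum_mul_single (b : ℕ → 𝕜) (k : ℕ) :
    ∑' j, b j * (Pi.single k 1 : ℕ → 𝕜) j = b k := by
  rw [tsum_eq_single k fun j hj => by rw [Pi.single_eq_of_ne hj, mul_zero]]
  simp

theorem bounded_tsum_mul (hB : RowsBounded B) {y : ℕ → 𝕜} (hy : Tendsto y atTop (𝓝 0)) :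
    BddAbove (Set.range fun n => ‖∑' k, B n k * y k‖) := by
  have hsum := hB.summable
  obtain ⟨C, hC⟩ := hB
  obtain ⟨M, hM⟩ := hy.norm.bddAbove_range
  have hM0 : 0 ≤ M := (norm_nonneg _).trans (hM ⟨0, rfl⟩)
  refine ⟨C * M, ?_⟩
  rintro _ ⟨n, rfl⟩
  have hs := summable_norm_mul_of_tendsto (hsum n) hy
  refine (norm_tsum_le_tsum_norm hs).trans (hs.tsum_le_of_sum_range_le fun N => ?_)
  calc ∑ k ∈ Finset.range N, ‖B n k * y k‖ ≤ ∑ k ∈ Finset.range N, ‖B n k‖ * M := by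
        refine Finset.sum_le_sum fun k _ => ?_
        rw [norm_mul]
        exact mul_le_mul_of_nonneg_left (hM ⟨k, rfl⟩) (norm_nonneg _)
    _ = (∑ k ∈ Finset.range N, ‖B n k‖) * M := by rw [Finset.sum_mul]
    _ ≤ C * M := mul_le_mul_of_nonneg_right (hC n N) hM0

theorem mapsTo_spaceLinf_iff (hB : ∀ n, Summable fun k => ‖B n k‖) :
    (∀ y : ℕ → 𝕜, Tendsto y atTop (𝓝 0) → (fun n => ∑' k, B n k * y k) ∈ spaceLinf 𝕜) ↔
      RowsBounded B :=
  ⟨fun h => rowsBounded_of_bounded B hB h, fun h _ hy => bounded_tsum_mul h hy⟩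

theorem mapsTo_spaceC_iff (hB : ∀ n, Summable fun k => ‖B n k‖) :
    (∀ y : ℕ → 𝕜, Tendsto y atTop (𝓝 0) → (fun n => ∑' k, B n k * y k) ∈ spaceC 𝕜) ↔
      RowsBounded B ∧ ∀ k, ∃ l : 𝕜, Tendsto (fun n => B n k) atTop (𝓝 l) := by
  constructor
  · intro h
    refine ⟨rowsBounded_of_bounded B hB fun y hy => ?_, fun k => ?_⟩
    · obtain ⟨l, hl⟩ := h y hy
      exact hl.norm.bddAbove_range
    -- The unit sequence `e_k` is null and is sent to the `k`-th column.
    · obtain ⟨l, hl⟩ := h _ (tendsto_single_zero k)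
      exact ⟨l, by simpa only [tsum_mul_single] using hl⟩
  · rintro ⟨h, hcol⟩ y hy
    choose b hb using hcol
    exact ⟨_, tendsto_tsum_mul h hb hy⟩

theorem mapsTo_spaceC0_iff (hB : ∀ n, Summable fun k => ‖B n k‖) :
    (∀ y : ℕ → 𝕜, Tendsto y atTop (𝓝 0) → (fun n => ∑' k, B n k * y k) ∈ spaceC0 𝕜) ↔
      RowsBounded B ∧ ∀ k, Tendsto (fun n => B n k) atTop (𝓝 0) := by
  constructor
  · intro h
    refine ⟨rowsBounded_of_bounded B hB fun y hy => (h y hy).norm.bddAbove_range, fun k => ?_⟩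
    have := h _ (tendsto_single_zero k)
    simp only [tsum_mul_single] at this
    exact this
  · rintro ⟨h, hcol⟩ y hy
    exact tendsto_tsum_mul_zero h hcol hy

theorem sum_range_norm_le_of_zero {f : ℕ → 𝕜} {M : ℕ} (hf : ∀ k, M ≤ k → f k = 0) (N : ℕ) :
    ∑ k ∈ Finset.range N, ‖f k‖ ≤ ∑ k ∈ Finset.range M, ‖f k‖ := by
  refine (Finset.sum_le_sum_of_subset_of_nonneg
    (Finset.range_subset_range.mpr (le_max_left N M)) fun _ _ _ => norm_nonneg _).trans_eq ?_
  symm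
  refine Finset.sum_subset (Finset.range_subset_range.mpr (le_max_right N M)) fun k _ hk => ?_
  rw [hf k (by simpa using hk), norm_zero]

end NullSequences

/-! ### Row conditions for `A` acting on `S c`. -/

section Rows

variable {𝕜 : Type*} [RCLike 𝕜] (r s t : ℕ → 𝕜) (A : ℕ → ℕ → 𝕜)

/-- The image of `y` under the inverse triangle `S`. -/
def invTransform (y : ℕ → 𝕜) (j : ℕ) : 𝕜 :=
  ∑ k ∈ Finset.range (j + 1), invTriangle r s t j k * y k

/-- The partial sums of the series which define `R_k(A_n)`. -/
def partialR (n m k : ℕ) : 𝕜 :=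
  ∑ j ∈ Finset.range m, A n j * invTriangle r s t j k

variable {r s t A}

theorem partialR_of_le (n : ℕ) {m k : ℕ} (h : m ≤ k) : partialR r s t A n m k = 0 :=
  Finset.sum_eq_zero fun j hj => by
    rw [invTriangle_of_lt r s t ((Finset.mem_range.mp hj).trans_le h), mul_zero]

/-- Triangularity lets every inner sum run up to `m`, after which the two finite sums commute. -/
theorem sum_mul_invTransform (y : ℕ → 𝕜) (n m : ℕ) :
    ∑ j ∈ Finset.range m, A n j * invTransform r s t y j
      = ∑ k ∈ Finset.range m, partialR r s t A n m k * y k := by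
  have h : ∀ j ∈ Finset.range m, A n j * invTransform r s t y j
      = ∑ k ∈ Finset.range m, A n j * invTriangle r s t j k * y k := fun j hj => by
    rw [invTransform, Finset.mul_sum]
    have hj' := Finset.mem_range.mp hj
    rw [← Finset.sum_subset (Finset.range_subset_range.mpr (Nat.succ_le_of_lt hj'))]
    · exact Finset.sum_congr rfl fun k _ => (mul_assoc _ _ _).symm
    · intro k _ hk
      rw [invTriangle_of_lt r s t (by simpa using hk), mul_zero, zero_mul]
  rw [Finset.sum_congr rfl h, Finset.sum_comm]
  simp only [partialR, Finset.sum_mul]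

theorem tsum_partialR_mul (y : ℕ → 𝕜) (n m : ℕ) :
    ∑' k, partialR r s t A n m k * y k
      = ∑ j ∈ Finset.range m, A n j * invTransform r s t y j := by
  rw [sum_mul_invTransform, tsum_eq_sum]
  intro k hk
  rw [partialR_of_le n (by simpa using hk), zero_mul]

theorem invTransform_single (k : ℕ) :
    invTransform r s t (Pi.single k 1) = fun j => invTriangle r s t j k := by
  ext j
  by_cases h : k ≤ j
  · rw [invTransform, Finset.sum_eq_single k]
    · simp
    · intro i _ hi
      rw [Pi.single_eq_of_ne hi, mul_zero]
    · intro hk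
      exact absurd (Finset.mem_range.mpr (Nat.lt_succ_of_le h)) hk
  · rw [invTriangle_of_lt r s t (not_le.mp h)]
    refine Finset.sum_eq_zero fun i hi => ?_
    rw [Pi.single_eq_of_ne (by have := Finset.mem_range.mp hi; omega), mul_zero]

theorem rowW_of_lt (n : ℕ) {m k : ℕ} (h : m < k) : rowW r s t A n m k = 0 :=
  if_neg (not_le.mpr h)

/-- A tail is the full sum minus the partial sum. The restriction `k ≤ m` matters: above the
diagonal `rowW` is `0` by definition, while the difference is `R_k(A_n)`. -/
theorem rowW_eq (h : RDefined r s t A) (n : ℕ) {m k : ℕ} (hk : k ≤ m) :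
    rowW r s t A n m k = rowR r s t A n k - partialR r s t A n m k := by
  rw [rowW, if_pos hk]
  refine seriesSum_eq_of_tendsto ?_
  have h1 := (((h n k).tendsto.comp (tendsto_add_atTop_nat m)).sub_const (partialR r s t A n m k))
  refine h1.congr fun N => ?_
  simp only [Function.comp_apply, partialR]
  rw [add_comm N m, Finset.sum_range_add, add_sub_cancel_left]

theorem tendsto_partialR (h : RDefined r s t A) (n k : ℕ) :
    Tendsto (fun m => partialR r s t A n m k) atTop (𝓝 (rowR r s t A n k)) :=
  (h n k).tendsto

/-- Tails of a convergent series tend to `0`, so this condition is automatic. -/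
theorem wColumnsConverge (h : RDefined r s t A) : WColumnsConverge r s t A := fun n k => by
  refine ⟨0, ?_⟩
  have h1 := (tendsto_partialR h n k).const_sub (rowR r s t A n k)
  rw [sub_self] at h1
  refine h1.congr' ?_
  filter_upwards [eventually_ge_atTop k] with m hm
  rw [rowW_eq h n hm]

/-- The factor `1` exhibits the last sum as `partialR` acting on the constant sequence `e`. -/
theorem sum_rowW_eq (h : RDefined r s t A) (n m : ℕ) :
    ∑ k ∈ Finset.range (m + 1), rowW r s t A n m k
      = ∑ k ∈ Finset.range (m + 1), rowR r s t A n k - ∑' k, partialR r s t A n m k * 1 := by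
  rw [tsum_eq_sum (s := Finset.range (m + 1)), ← Finset.sum_sub_distrib]
  · refine Finset.sum_congr rfl fun k hk => ?_
    rw [rowW_eq h n (Nat.lt_succ_iff.mp (Finset.mem_range.mp hk)), mul_one]
  · intro k hk
    rw [partialR_of_le n (by have := Finset.mem_range.not.mp hk; omega), zero_mul]

theorem tendsto_sum_rowR {n : ℕ} (hR : Summable fun k => ‖rowR r s t A n k‖) :
    Tendsto (fun m => ∑ k ∈ Finset.range (m + 1), rowR r s t A n k) atTop
      (𝓝 (∑' k, rowR r s t A n k)) :=
  hR.of_norm.hasSum.tendsto_sum_nat.comp (tendsto_add_atTop_nat 1)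

theorem defect_eq {n : ℕ} (hR : Summable fun k => ‖rowR r s t A n k‖) :
    defect r s t A n = ∑' k, rowR r s t A n k - gammaLim r s t A n := by
  simp only [defect, transform, mul_one]
  rw [seriesSum_eq_tsum hR.of_norm]

theorem rowsBounded_partialR (h : RDefined r s t A) {n : ℕ}
    (hR : Summable fun k => ‖rowR r s t A n k‖)
    (hW : BddAbove (Set.range fun m => ∑ k ∈ Finset.range (m + 1), ‖rowW r s t A n m k‖)) :
    RowsBounded (partialR r s t A n) := by
  obtain ⟨C, hC⟩ := hW
  refine ⟨∑' k, ‖rowR r s t A n k‖ + C, fun m N => ?_⟩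
  have hle : ∀ k, ‖partialR r s t A n m k‖ ≤ ‖rowR r s t A n k‖ + ‖rowW r s t A n m k‖ :=
    fun k => by
      rcases le_or_gt k m with hk | hk
      · have : partialR r s t A n m k = rowR r s t A n k - rowW r s t A n m k := by
          rw [rowW_eq h n hk, sub_sub_cancel]
        rw [this]
        exact norm_sub_le _ _
      · rw [partialR_of_le n hk.le, norm_zero]
        positivity
  refine (Finset.sum_le_sum fun k _ => hle k).trans ?_
  rw [Finset.sum_add_distrib]
  refine add_le_add (hR.sum_le_tsum _ fun _ _ => norm_nonneg _) ?_
  exact (sum_range_norm_le_of_zero (fun k hk => rowW_of_lt n hk) N).trans (hC ⟨m, rfl⟩)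

/-- The value of `(A x)_n` for `x = S y` and a convergent sequence `y`. -/
theorem tendsto_sum_mul_invTransform (h : RDefined r s t A) {n : ℕ}
    (hR : Summable fun k => ‖rowR r s t A n k‖)
    (hW : BddAbove (Set.range fun m => ∑ k ∈ Finset.range (m + 1), ‖rowW r s t A n m k‖))
    (hsum : ∃ l : 𝕜,
      Tendsto (fun m => ∑ k ∈ Finset.range (m + 1), rowW r s t A n m k) atTop (𝓝 l))
    {y : ℕ → 𝕜} {l : 𝕜} (hy : Tendsto y atTop (𝓝 l)) :
    Tendsto (fun m => ∑ j ∈ Finset.range m, A n j * invTransform r s t y j) atTop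
      (𝓝 (∑' k, rowR r s t A n k * (y k - l) + l * defect r s t A n)) := by
  have hV := rowsBounded_partialR h hR hW
  have hy0 : Tendsto (fun k => y k - l) atTop (𝓝 0) := by simpa using hy.sub_const l
  -- The null part `y - l` is handled by bounded rows and convergent columns; `h2` handles the
  -- constant part through row sums.
  have h1 := tendsto_tsum_mul hV (tendsto_partialR h n) hy0
  have hγ : Tendsto (fun m => ∑ k ∈ Finset.range (m + 1), rowW r s t A n m k) atTop
      (𝓝 (gammaLim r s t A n)) := tendsto_nhds_limUnder hsum
  have h2 : Tendsto (fun m => ∑' k, partialR r s t A n m k * 1) atTop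
      (𝓝 (defect r s t A n)) := by
    rw [defect_eq hR]
    refine ((tendsto_sum_rowR hR).sub hγ).congr fun m => ?_
    rw [sum_rowW_eq h, sub_sub_cancel]
  refine (h1.add (h2.const_mul l)).congr fun m => ?_
  have hs := hV.summable m
  rw [← tsum_partialR_mul, ← tsum_mul_left,
    ← (summable_norm_mul_of_tendsto hs hy0).of_norm.tsum_add
      ((summable_norm_mul_of_tendsto hs tendsto_const_nhds).of_norm.mul_left l)]
  exact tsum_congr fun k => by ring

/-- `S e_k` is the `k`-th column of `S`, so unit sequences suffice. -/
theorem rDefined_of_seriesConverges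
    (h : ∀ y ∈ spaceC 𝕜, ∀ n, SeriesConverges fun j => A n j * invTransform r s t y j) :
    RDefined r s t A := fun n k => by
  simpa only [invTransform_single] using h _ ⟨0, tendsto_single_zero k⟩ n

/-- For fixed `n`, Banach–Steinhaus bounds the rows of `partialR`; the limit row `R` inherits the
bound, and `W = R - partialR` on the triangle. The sequence `e` yields the row sums. -/
theorem row_conditions_of_seriesConverges
    (h : ∀ y ∈ spaceC 𝕜, ∀ n, SeriesConverges fun j => A n j * invTransform r s t y j) :
    (∀ n, Summable fun k => ‖rowR r s t A n k‖) ∧ WRowsBounded r s t A ∧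
      WRowSumsConverge r s t A := by
  have hdef := rDefined_of_seriesConverges h
  have hV : ∀ n, RowsBounded (partialR r s t A n) := fun n => by
    refine rowsBounded_of_bounded _ (fun m => ?_) fun y hy => ?_
    · refine summable_of_ne_finset_zero (s := Finset.range m) fun k hk => ?_
      rw [partialR_of_le n (by simpa using hk), norm_zero]
    · obtain ⟨l, hl⟩ := h y ⟨0, hy⟩ n
      simp only [tsum_partialR_mul]
      exact hl.norm.bddAbove_range
  have hR : ∀ n, Summable fun k => ‖rowR r s t A n k‖ := fun n => by
    obtain ⟨C, hC⟩ := hV n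
    exact summable_of_sum_range_le (fun _ => norm_nonneg _)
      (sum_norm_le_of_tendsto hC (tendsto_partialR hdef n))
  refine ⟨hR, fun n => ?_, fun n => ?_⟩
  · obtain ⟨C, hC⟩ := hV n
    refine ⟨∑' k, ‖rowR r s t A n k‖ + C, ?_⟩
    rintro _ ⟨m, rfl⟩
    have hle : ∀ k ∈ Finset.range (m + 1),
        ‖rowW r s t A n m k‖ ≤ ‖rowR r s t A n k‖ + ‖partialR r s t A n m k‖ := fun k hk => by
      rw [rowW_eq hdef n (Nat.lt_succ_iff.mp (Finset.mem_range.mp hk))]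
      exact norm_sub_le _ _
    refine (Finset.sum_le_sum hle).trans ?_
    rw [Finset.sum_add_distrib]
    exact add_le_add ((hR n).sum_le_tsum _ fun _ _ => norm_nonneg _) (hC m _)
  · obtain ⟨l, hl⟩ := h (fun _ => 1) ⟨1, tendsto_const_nhds⟩ n
    refine ⟨_, ((tendsto_sum_rowR (hR n)).sub hl).congr fun m => ?_⟩
    rw [sum_rowW_eq hdef, tsum_partialR_mul (fun _ => 1)]

theorem mem_genMeansSpace_iff (hr : ∀ n, r n ≠ 0) (hs : s 0 ≠ 0) (ht : ∀ n, t n ≠ 0)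
    (X : Set (ℕ → 𝕜)) (x : ℕ → 𝕜) :
    x ∈ genMeansSpace X r s t ↔ ∃ y ∈ X, x = invTransform r s t y := by
  constructor
  · intro hx
    exact ⟨_, hx, funext ((genMeans_eq_iff r s t hr hs ht x _).mp fun _ => rfl)⟩
  · rintro ⟨y, hy, rfl⟩
    have := funext ((genMeans_eq_iff r s t hr hs ht (invTransform r s t y) y).mpr fun _ => rfl)
    rw [genMeansSpace, Set.mem_ofPred_eq, this]
    exact hy

/-- Only linearity of `Y` is needed to recombine the null and constant parts, so all three targets
are treated at once. -/
theorem mem_matrixClass_iff (hr : ∀ n, r n ≠ 0) (hs : s 0 ≠ 0) (ht : ∀ n, t n ≠ 0)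
    {Y : Set (ℕ → 𝕜)} (hadd : ∀ u ∈ Y, ∀ v ∈ Y, (fun n => u n + v n) ∈ Y)
    (hsmul : ∀ (c : 𝕜), ∀ u ∈ Y, (fun n => c * u n) ∈ Y) :
    A ∈ matrixClass (genMeansSpace (spaceC 𝕜) r s t) Y ↔
      RDefined r s t A ∧ (∀ n, Summable fun k => ‖rowR r s t A n k‖) ∧ WRowsBounded r s t A ∧
        WRowSumsConverge r s t A ∧
        (∀ y : ℕ → 𝕜, Tendsto y atTop (𝓝 0) → (fun n => ∑' k, rowR r s t A n k * y k) ∈ Y) ∧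
        defect r s t A ∈ Y := by
  have hclass : A ∈ matrixClass (genMeansSpace (spaceC 𝕜) r s t) Y ↔
      ∀ y ∈ spaceC 𝕜, (∀ n, SeriesConverges fun j => A n j * invTransform r s t y j) ∧
        transform A (invTransform r s t y) ∈ Y := by
    refine ⟨fun h y hy => h _ ((mem_genMeansSpace_iff hr hs ht _ _).mpr ⟨y, hy, rfl⟩),
      fun h x hx => ?_⟩
    obtain ⟨y, hy, rfl⟩ := (mem_genMeansSpace_iff hr hs ht _ _).mp hx
    exact h y hy
  rw [hclass]
  constructor
  · intro h
    have hconv : ∀ y ∈ spaceC 𝕜, ∀ n, SeriesConverges fun j => A n j * invTransform r s t y j :=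
      fun y hy => (h y hy).1
    have hdef := rDefined_of_seriesConverges hconv
    obtain ⟨hR, hW, hsum⟩ := row_conditions_of_seriesConverges hconv
    have hval : ∀ (y : ℕ → 𝕜) (l : 𝕜), Tendsto y atTop (𝓝 l) →
        (fun n => ∑' k, rowR r s t A n k * (y k - l) + l * defect r s t A n) ∈ Y :=
      fun y l hy => by
        have := (h y ⟨l, hy⟩).2
        convert this using 1
        exact funext fun n => (seriesSum_eq_of_tendsto
          (tendsto_sum_mul_invTransform hdef (hR n) (hW n) (hsum n) hy)).symm
    refine ⟨hdef, hR, hW, hsum, fun y hy => ?_, ?_⟩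
    · simpa only [sub_zero, zero_mul, add_zero] using hval y 0 hy
    -- For `y = e`, `l = 1` the series vanishes and only the defect remains.
    · simpa using hval (fun _ => 1) 1 tendsto_const_nhds
  · rintro ⟨hdef, hR, hW, hsum, hnull, hdefect⟩ y ⟨l, hy⟩
    have hlim := fun n => tendsto_sum_mul_invTransform hdef (hR n) (hW n) (hsum n) hy
    refine ⟨fun n => ⟨_, hlim n⟩, ?_⟩
    have hT : transform A (invTransform r s t y) = fun n =>
        ∑' k, rowR r s t A n k * (y k - l) + l * defect r s t A n :=
      funext fun n => seriesSum_eq_of_tendsto (hlim n)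
    rw [hT]
    exact hadd _ (hnull _ (by simpa using hy.sub_const l)) _ (hsmul l _ hdefect)

theorem rRowsBounded_iff : RRowsBounded r s t A ↔ RowsBounded (rowR r s t A) :=
  iSup_tsum_enorm_lt_top_iff _

end Rows

end GenMeans

end

theorem corollary4p2 {𝕜 : Type*} [RCLike 𝕜] (r s t : ℕ → 𝕜)
    (hr : ∀ n, r n ≠ 0) (hs : s 0 ≠ 0) (ht : ∀ n, t n ≠ 0) (A : ℕ → ℕ → 𝕜) :
    (A ∈ GenMeans.matrixClass (GenMeans.genMeansSpace (GenMeans.spaceC 𝕜) r s t)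
          (GenMeans.spaceC0 𝕜) ↔
        GenMeans.RDefined r s t A ∧ GenMeans.RRowsBounded r s t A ∧
        GenMeans.RColumnsNull r s t A ∧ GenMeans.WRowsBounded r s t A ∧
        GenMeans.WColumnsConverge r s t A ∧ GenMeans.WRowSumsConverge r s t A ∧
        GenMeans.defect r s t A ∈ GenMeans.spaceC0 𝕜) ∧
    (A ∈ GenMeans.matrixClass (GenMeans.genMeansSpace (GenMeans.spaceC 𝕜) r s t)
          (GenMeans.spaceC 𝕜) ↔
        GenMeans.RDefined r s t A ∧ GenMeans.RRowsBounded r s t A ∧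
        GenMeans.WRowsBounded r s t A ∧ GenMeans.RColumnsConverge r s t A ∧
        GenMeans.WColumnsConverge r s t A ∧ GenMeans.WRowSumsConverge r s t A ∧
        GenMeans.defect r s t A ∈ GenMeans.spaceC 𝕜) ∧
    (A ∈ GenMeans.matrixClass (GenMeans.genMeansSpace (GenMeans.spaceC 𝕜) r s t)
          (GenMeans.spaceLinf 𝕜) ↔
        GenMeans.RDefined r s t A ∧ GenMeans.RRowsBounded r s t A ∧
        GenMeans.WRowsBounded r s t A ∧
        GenMeans.WColumnsConverge r s t A ∧ GenMeans.WRowSumsConverge r s t A ∧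
        GenMeans.defect r s t A ∈ GenMeans.spaceLinf 𝕜) := by
  refine ⟨?_, ?_, ?_⟩
  · rw [GenMeans.mem_matrixClass_iff hr hs ht]
    · constructor
      · rintro ⟨h0, hR, hW, hsum, hnull, hd⟩
        obtain ⟨hb, hc⟩ := (GenMeans.mapsTo_spaceC0_iff hR).mp hnull
        exact ⟨h0, GenMeans.rRowsBounded_iff.mpr hb, hc, hW, GenMeans.wColumnsConverge h0, hsum, hd⟩
      · rintro ⟨h0, hb, hc, hW, -, hsum, hd⟩
        have hb' := GenMeans.rRowsBounded_iff.mp hb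
        exact ⟨h0, hb'.summable, hW, hsum,
          (GenMeans.mapsTo_spaceC0_iff hb'.summable).mpr ⟨hb', hc⟩, hd⟩
    · intro u hu v hv
      have := Filter.Tendsto.add hu hv
      rwa [add_zero] at this
    · intro c u hu
      have := Filter.Tendsto.const_mul c hu
      rwa [mul_zero] at this
  · rw [GenMeans.mem_matrixClass_iff hr hs ht]
    · constructor
      · rintro ⟨h0, hR, hW, hsum, hnull, hd⟩
        obtain ⟨hb, hc⟩ := (GenMeans.mapsTo_spaceC_iff hR).mp hnull
        exact ⟨h0, GenMeans.rRowsBounded_iff.mpr hb, hW, hc, GenMeans.wColumnsConverge h0, hsum, hd⟩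
      · rintro ⟨h0, hb, hW, hc, -, hsum, hd⟩
        have hb' := GenMeans.rRowsBounded_iff.mp hb
        exact ⟨h0, hb'.summable, hW, hsum,
          (GenMeans.mapsTo_spaceC_iff hb'.summable).mpr ⟨hb', hc⟩, hd⟩
    · rintro u ⟨a, hu⟩ v ⟨b, hv⟩
      exact ⟨_, hu.add hv⟩
    · rintro c u ⟨a, hu⟩
      exact ⟨_, hu.const_mul c⟩
  · rw [GenMeans.mem_matrixClass_iff hr hs ht]
    · constructor
      · rintro ⟨h0, hR, hW, hsum, hnull, hd⟩
        have hb := (GenMeans.mapsTo_spaceLinf_iff hR).mp hnull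
        exact ⟨h0, GenMeans.rRowsBounded_iff.mpr hb, hW, GenMeans.wColumnsConverge h0, hsum, hd⟩
      · rintro ⟨h0, hb, hW, -, hsum, hd⟩
        have hb' := GenMeans.rRowsBounded_iff.mp hb
        exact ⟨h0, hb'.summable, hW, hsum,
          (GenMeans.mapsTo_spaceLinf_iff hb'.summable).mpr hb', hd⟩
    · rintro u ⟨a, hu⟩ v ⟨b, hv⟩
      refine ⟨a + b, ?_⟩
      rintro _ ⟨n, rfl⟩
      exact (norm_add_le _ _).trans (add_le_add (hu ⟨n, rfl⟩) (hv ⟨n, rfl⟩))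
    · rintro c u ⟨a, hu⟩
      refine ⟨‖c‖ * a, ?_⟩
      rintro _ ⟨n, rfl⟩
      exact (norm_mul_le _ _).trans (mul_le_mul_of_nonneg_left (hu ⟨n, rfl⟩) (norm_nonneg c))
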